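/- Let $\lambda$ be a regular cardinal and let $\mathcal V=(\mathcal V_0,\otimes,I)$ be a symmetric monoidal closed, complete and cocomplete category (with small hom-sets) which is a symmetric monoidal $\lambda$-quasivariety. That is: there is a small family $\mathcal P$ of objects of $\mathcal V_0$ that is a regular generator (for every $X$ the canonical morphism $\coprod_{P\in\mathcal P,\;P\to X}P\to X$ is a regular epimorphism) such that each $P\in\mathcal P$ is $\lambda$-presentable and regular projective (morphisms out of it lift along regular epimorphisms); for all $P,Q\in\mathcal P$ the object $P\otimes Q$ is $\lambda$-presentable and regular projective; and $I$ is $\lambda$-presentable. Let $\mathcal E$ be the class of regular epimorphisms and $\mathcal M$ the class of monomorphisms of $\mathcal V_0$; these form a factorization system on $\mathcal V_0$. Let $\mathcal K$ be a locally $\lambda$-presentable $\mathcal V$-category: it has all small conical colimits and all copowers by objects of $\mathcal V$; the full subcategory $\mathcal K_\lambda$ of objects $A$ for which $\mathcal K(A,-)\colon\mathcal K\to\mathcal V$ preserves $\lambda$-filtered colimits is essentially small; and every object of $\mathcal K$ is a $\lambda$-filtered colimit of objects of $\mathcal K_\lambda$. A morphism $s\colon X\to Y$ in $\mathcal K$ is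 an *$\mathcal E$-split monomorphism* if $\mathcal K(s,X)\colon\mathcal K(Y,X)\to\mathcal K(X,X)$ is in $\mathcal E$. A morphism $f\colon X\to Y$ in $\mathcal K$ is *$(\lambda,\mathcal E)$-pure* if for every morphism $g\colon A\to B$ with $A,B\in\mathcal K_\lambda$ the following holds: if $\mathcal K(B,Y)\twoheadrightarrow\mathcal P(g,Y)\rightarrowtail\mathcal K(A,Y)$ is the $(\mathcal E,\mathcal M)$-factorization of $\mathcal K(g,Y)$, and $\mathcal P(g,f)$ is the pullback of $\mathcal P(g,Y)\rightarrowtail\mathcal K(A,Y)$ along $\mathcal K(A,f)\colon\mathcal K(A,X)\to\mathcal K(A,Y)$, then the morphism $\mathcal K(B,X)\to\mathcal P(g,f)$ induced by $\mathcal K(g,X)$ and $\mathcal K(B,f)$ is in $\mathcal E$. Then: 1. every $\mathcal E$-split monomorphism in $\mathcal K$ is $(\lambda,\mathcal E)$-pure; 2. every $\lambda$-filtered colimit, in the category of arrows $\mathcal K^\to$, of $(\lambda,\mathcal E)$-pure morphisms is $(\lambda,\mathcal E)$-pure; 3. every $(\lambda,\mathcal E)$-pure morphism in $\mathcal K$ is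 a $\lambda$-filtered colimit in $\mathcal K^\to$ of $\mathcal E$-split monomorphisms. -/

import Mathlib

open CategoryTheory Category Limits MonoidalCategory Opposite

universe w u u'

namespace EnrichedPurity

section Base

variable {V : Type u} [Category.{w} V]

/-- An object `P` is regular projective if morphisms out of `P` lift along regular epimorphisms. -/
def IsRegularProjective (P : V) : Prop :=
  ∀ ⦃X Y : V⦄ (e : X ⟶ Y), IsRegularEpi e → ∀ f : P ⟶ Y, ∃ g : P ⟶ X, g ≫ e = f

/-- A small family of objects `G` is a regular generator if, for every object `X`, the canonical
morphism to `X` from the coproduct of copies of the `G i`, one for each `i` and each morphism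
`G i ⟶ X`, is a regular epimorphism. -/
def IsRegularGenerator [HasColimitsOfSize.{w, w} V] {ι : Type w} (G : ι → V) : Prop :=
  ∀ X : V, IsRegularEpi
    (Sigma.desc (fun p : Σ i, (G i ⟶ X) => p.2) : (∐ fun p : Σ i, (G i ⟶ X) => G p.1) ⟶ X)

/-- A symmetric monoidal `κ`-quasivariety: a (cocomplete) symmetric monoidal closed category with a
regular generator made of `κ`-presentable regular projective objects, whose binary tensor products
are again `κ`-presentable and regular projective, and with a `κ`-presentable unit. -/
class IsSymmetricMonoidalQuasivariety (V : Type u) [Category.{w} V] [MonoidalCategory V]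
    [SymmetricCategory V] [MonoidalClosed V] [HasColimitsOfSize.{w, w} V]
    (κ : Cardinal.{w}) [Fact κ.IsRegular] : Prop where
  exists_generator : ∃ (ι : Type w) (G : ι → V), IsRegularGenerator G ∧
    (∀ i, IsCardinalPresentable (G i) κ ∧ IsRegularProjective (G i)) ∧
    (∀ i j, IsCardinalPresentable (G i ⊗ G j) κ ∧ IsRegularProjective (G i ⊗ G j))
  unit_presentable : IsCardinalPresentable (𝟙_ V) κ

end Base

section Enriched

variable (V : Type u) [Category.{w} V] [MonoidalCategory V]
variable {K : Type u'} [Category.{w} K] [EnrichedOrdinaryCategory V K]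

/-- All small conical colimits exist in `K`: the underlying ordinary category has small colimits,
and each contravariant hom-functor `K(-, X) : Kᵒᵖ ⥤ V` turns them into limits in `V`. -/
class HasConicalColimits (K : Type u') [Category.{w} K] [EnrichedOrdinaryCategory V K] : Prop
    extends HasColimitsOfSize.{w, w} K where
  preservesLimits (X : K) : PreservesLimitsOfSize.{w, w} ((eHomFunctor V K).flip.obj X)

variable {V} in
/-- `u : X ⟶ K(A, C)` exhibits `C` as the copower of `A` by `X`: for each `B`, the morphism
`K(C, B) ⟶ [X, K(A, B)]` which is the transpose of
`X ⊗ K(C, B) ⟶ K(A, C) ⊗ K(C, B) ⟶ K(A, B)` is invertible. -/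
def IsCopower [MonoidalClosed V] (X : V) (A C : K) (u : X ⟶ (A ⟶[V] C)) : Prop :=
  ∀ B : K, IsIso (MonoidalClosed.curry (u ▷ (C ⟶[V] B) ≫ eComp V A C B))

/-- `K` has all copowers by objects of `V`. -/
def HasCopowers [MonoidalClosed V] (K : Type u') [Category.{w} K]
    [EnrichedOrdinaryCategory V K] : Prop :=
  ∀ (X : V) (A : K), ∃ (C : K) (u : X ⟶ (A ⟶[V] C)), IsCopower X A C u

/-- `A` is `κ`-presentable in the enriched sense: the functor `K(A, -) : K ⥤ V` preserves
`κ`-filtered colimits. (This is used for `K` with all conical colimits, in which every colimit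
in the underlying category is conical.) -/
def enrichedPresentable (κ : Cardinal.{w}) [Fact κ.IsRegular] : ObjectProperty K :=
  fun A => (eCoyoneda V A).IsCardinalAccessible κ

/-- `K` is locally `κ`-presentable as a `V`-category: it has all conical colimits and all
copowers, its (enriched) `κ`-presentable objects form an essentially small full subcategory,
and each object is a `κ`-filtered colimit of `κ`-presentable ones. -/
class IsLocallyPresentable [MonoidalClosed V] (K : Type u') [Category.{w} K]
    [EnrichedOrdinaryCategory V K] (κ : Cardinal.{w}) [Fact κ.IsRegular] : Prop
    extends HasConicalColimits V K where
  hasCopowers : HasCopowers V K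
  essentiallySmall : ObjectProperty.EssentiallySmall.{w}
    (enrichedPresentable V κ : ObjectProperty K)
  exists_colimitPresentation (X : K) :
    ∃ (J : Type w) (_ : SmallCategory J) (_ : IsCardinalFiltered J κ)
      (p : ColimitPresentation J X), ∀ j, enrichedPresentable V κ (p.diag.obj j)

variable {V}
variable (E M : MorphismProperty V)

/-- `s : X ⟶ Y` is an `E`-split monomorphism if `K(s, X) : K(Y, X) ⟶ K(X, X)` is in `E`. -/
def IsSplit {X Y : K} (s : X ⟶ Y) : Prop := E (eHomWhiskerRight V s X)

variable [HasPullbacks V] {X Y A B : K} (f : X ⟶ Y) (g : A ⟶ B)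

variable {E M} in
/-- Given an `(E, M)`-factorization `K(B, Y) ⟶ P(g, Y) ⟶ K(A, Y)` of `K(g, Y)`, the morphism
`r : K(B, X) ⟶ P(g, f)` into the pullback of `K(A, f)` and `P(g, Y) ⟶ K(A, Y)`. -/
noncomputable def purityMap (φ : E.MapFactorizationData M (eHomWhiskerRight V g Y)) :
    (B ⟶[V] X) ⟶ pullback (eHomWhiskerLeft V A f) φ.p :=
  pullback.lift (eHomWhiskerRight V g X) (eHomWhiskerLeft V B f ≫ φ.i)
    (by rw [assoc, φ.fac, eHom_whisker_exchange])

/-- `f` is `E`-pure with respect to `g` if the comparison map `r` lies in `E`. The choice of the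
`(E, M)`-factorization is immaterial when `(E, M)` is a factorization system, factorizations being
then unique up to a unique isomorphism. -/
def IsPureWrt : Prop :=
  ∃ φ : E.MapFactorizationData M (eHomWhiskerRight V g Y), E (purityMap f g φ)

/-- `f` is `(κ, E)`-pure if it is `E`-pure with respect to every morphism between `κ`-presentable
objects. -/
def IsPure (κ : Cardinal.{w}) [Fact κ.IsRegular] : Prop :=
  ∀ ⦃A B : K⦄ (g : A ⟶ B), enrichedPresentable V κ A → enrichedPresentable V κ B →
    IsPureWrt E M f g

end Enriched

end EnrichedPurity

/-!
The generators `G i` reduce everything to a statement about the morphisms `G i ⟶ X`, the *points*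
of `X`. A morphism of `V` is a regular epimorphism if and only if it is surjective on points
(`isRegularEpi_of_forall_generator`), and one that is injective on points is a monomorphism.
Hence purity of `f` with respect to `g : A ⟶ B` is a lifting property: a point `p` of `K(A, X)`
whose image in `K(A, Y)` comes from a point of `K(B, Y)` comes from a point of `K(B, X)`
(`isPureWrt_iff_forall_generator`).

A split monomorphism `s : X ⟶ Y` in the sense of regular epimorphisms need not have a retraction,
but it has one locally: the identity `𝟙_ V ⟶ K(X, X)` lifts to `K(Y, X)` after some regular
epimorphism `U ⟶ 𝟙_ V`, and this characterizes such `s` (`isSplit_iff_exists_cover`). The reason is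
that tensoring preserves regular epimorphisms, so that `G i ⊗ U ⟶ G i` splits by projectivity of
`G i`; composing with the local retraction then lifts arbitrary points. The same
argument shows that split monomorphisms are pure (`isPureWrt_of_isSplit`).

For a filtered colimit of pure morphisms, the data of the lifting property live at some stage,
because the `G i` are presentable in `V` and `A`, `B` are enriched presentable in `K`
(`isPureWrt_of_colimitPresentation`).

For the decomposition of a pure morphism `f : X ⟶ Y`, the enriched presentable objects are
first seen to be the presentable objects of the underlying category, which is therefore locally
presentable. So is its category of arrows, where `f` is a filtered colimit of arrows
`f_j : X_j ⟶ Y_j` between presentable objects (`exists_colimitPresentation_arrow`). Then `f` is also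
the colimit of the pushouts `X ⟶ X ⨿_{X_j} Y_j` of the `f_j`
(`exists_colimitPresentation_pushoutDiagram`). Purity of `f` extends `X_j ⟶ X` along `f_j` on
each point of the unit, hence on the canonical cover of the unit, and so these pushouts are split
monomorphisms (`isSplit_of_isPushout`).
-/

namespace EnrichedPurity

/-! ### Regular epimorphisms and monomorphisms in a quasivariety -/

section Base

variable {V : Type u} [Category.{w} V]

lemma mono_of_forall_generator [HasColimitsOfSize.{w, w} V] {ι : Type w} {G : ι → V}
    (hG : IsRegularGenerator G) {X Y : V} (m : X ⟶ Y)
    (hm : ∀ i (u v : G i ⟶ X), u ≫ m = v ≫ m → u = v) : Mono m where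
  right_cancellation {Z} a b hab := by
    have := hG Z
    have : Epi (Sigma.desc (fun p : Σ i, (G i ⟶ Z) => p.2)) := inferInstance
    rw [← cancel_epi (Sigma.desc (fun p : Σ i, (G i ⟶ Z) => p.2))]
    refine Sigma.hom_ext _ _ fun p => ?_
    simpa using hm p.1 (p.2 ≫ a) (p.2 ≫ b) (by simp [hab])

/-- A morphism is a regular epimorphism as soon as all morphisms from the generators lift
along it: the canonical morphism `c` from a coproduct of generators then factors through it, say
`c = h ≫ e`, and a morphism coequalizing the kernel pair of `e` descends along `c`, since
precomposing it with `h` gives a morphism that coequalizes the kernel pair of `c`. -/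
lemma isRegularEpi_of_forall_generator [HasColimitsOfSize.{w, w} V] [HasPullbacks V]
    {ι : Type w} {G : ι → V} (hG : IsRegularGenerator G) {X Y : V} (e : X ⟶ Y)
    (he : ∀ i (y : G i ⟶ Y), ∃ x : G i ⟶ X, x ≫ e = y) : IsRegularEpi e := by
  choose l hl using he
  let c := Sigma.desc (fun p : Σ i, (G i ⟶ Y) => p.2)
  let h : (∐ fun p : Σ i, (G i ⟶ Y) => G p.1) ⟶ X := Sigma.desc (fun p => l p.1 p.2)
  have hc : h ≫ e = c := Sigma.hom_ext _ _ fun p => by simp [h, c, hl]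
  have hY : IsRegularEpi c := hG Y
  let r := IsRegularEpi.getStruct c
  have : Epi c := inferInstance
  have : Epi e := epi_of_epi_fac hc
  have key : ∀ (s : Cofork (pullback.fst e e) (pullback.snd e e)) {T : V} (a b : T ⟶ X),
      a ≫ e = b ≫ e → a ≫ s.π = b ≫ s.π := fun s T a b hab => by
    have := pullback.lift a b hab ≫= s.condition
    rwa [pullback.lift_fst_assoc, pullback.lift_snd_assoc] at this
  refine ⟨⟨regularEpiOfKernelPair e (Cofork.IsColimit.mk' _ fun s => ?_)⟩⟩
  have hs : r.left ≫ h ≫ s.π = r.right ≫ h ≫ s.π := by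
    simpa using key s (r.left ≫ h) (r.right ≫ h) (by simp [hc, r.w])
  let d := Cofork.IsColimit.desc r.isColimit (h ≫ s.π) hs
  have hd : c ≫ d = h ≫ s.π := Cofork.IsColimit.π_desc' r.isColimit _ hs
  refine ⟨d, ?_, fun {m} hm => ?_⟩
  · have hX : IsRegularEpi (Sigma.desc (fun p : Σ i, (G i ⟶ X) => p.2)) := hG X
    have : Epi (Sigma.desc (fun p : Σ i, (G i ⟶ X) => p.2)) := inferInstance
    rw [← cancel_epi (Sigma.desc (fun p : Σ i, (G i ⟶ X) => p.2))]
    refine Sigma.hom_ext _ _ fun p => ?_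
    have h1 : p.2 ≫ e ≫ d = l p.1 (p.2 ≫ e) ≫ s.π := by
      have := Sigma.ι (fun p : Σ i, (G i ⟶ Y) => G p.1) ⟨p.1, p.2 ≫ e⟩ ≫= hd
      simpa [c, h] using this
    simpa [h1] using key s _ _ (hl p.1 (p.2 ≫ e))
  · rw [← cancel_epi c, hd, ← hc, assoc]
    exact h ≫= hm

/-- Every morphism factors through the coequalizer of its kernel pair, and the second part of this
factorization is injective on morphisms from regular projective generators. -/
lemma hasFactorization_regularEpi_monomorphisms [HasColimitsOfSize.{w, w} V] [HasPullbacks V]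
    {ι : Type w} {G : ι → V} (hG : IsRegularGenerator G) (hG' : ∀ i, IsRegularProjective (G i)) :
    (MorphismProperty.regularEpi V).HasFactorization (MorphismProperty.monomorphisms V) where
  nonempty_mapFactorizationData {X Y} f := by
    have : HasCoequalizers V := inferInstance
    let q := coequalizer.π (pullback.fst f f) (pullback.snd f f)
    have hq : IsRegularEpi q := inferInstance
    let m := coequalizer.desc (f := pullback.fst f f) (g := pullback.snd f f) f pullback.condition
    have hqm : q ≫ m = f := coequalizer.π_desc _ _
    refine ⟨⟨_, q, m, hqm, hq, ?_⟩⟩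
    refine mono_of_forall_generator hG m fun i a b hab => ?_
    obtain ⟨a, rfl⟩ := hG' i q hq a
    obtain ⟨b, rfl⟩ := hG' i q hq b
    have h : a ≫ f = b ≫ f := by simpa [hqm] using hab
    have := pullback.lift a b h ≫= coequalizer.condition (pullback.fst f f) (pullback.snd f f)
    rwa [pullback.lift_fst_assoc, pullback.lift_snd_assoc] at this

end Base

/-! ### Enriched and ordinary presentability -/

section Presentable

variable (V : Type u) [Category.{w} V] [MonoidalCategory V]
variable {K : Type u'} [Category.{w} K] [EnrichedOrdinaryCategory V K]
variable (κ : Cardinal.{w}) [Fact κ.IsRegular]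

lemma eHomEquiv_comp_eHomWhiskerLeft {A B C : K} (x : A ⟶ B) (f : B ⟶ C) :
    eHomEquiv V x ≫ eHomWhiskerLeft V A f = eHomEquiv V (x ≫ f) := by
  rw [eHomEquiv_comp, eHomWhiskerLeft, MonoidalCategory.tensorHom_def,
    rightUnitor_inv_naturality_assoc, unitors_inv_equal, assoc]

lemma eHomEquiv_comp_eHomWhiskerRight {A B C : K} (x : B ⟶ C) (f : A ⟶ B) :
    eHomEquiv V x ≫ eHomWhiskerRight V f C = eHomEquiv V (f ≫ x) := by
  rw [eHomEquiv_comp, eHomWhiskerRight, tensorHom_def', leftUnitor_inv_naturality_assoc, assoc]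

/-- The underlying set of `K(A, B)` is the set of morphisms from `A` to `B`, naturally in `B`. -/
def eCoyonedaCompCoyonedaUnitIso (A : K) :
    eCoyoneda V A ⋙ coyoneda.obj (op (𝟙_ V)) ≅ coyoneda.obj (op A) :=
  NatIso.ofComponents (fun B => (eHomEquiv V (X := A) (Y := B)).symm.toIso) (fun {B C} f => by
    ext x
    obtain ⟨x, rfl⟩ := (eHomEquiv V).surjective x
    apply (eHomEquiv V).injective
    change eHomEquiv V ((eHomEquiv V).symm (eHomEquiv V x ≫ eHomWhiskerLeft V A f)) =
      eHomEquiv V ((eHomEquiv V).symm (eHomEquiv V x) ≫ f)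
    simp [eHomEquiv_comp_eHomWhiskerLeft])

lemma isCardinalPresentable_of_enrichedPresentable [IsCardinalPresentable (𝟙_ V) κ] {A : K}
    (hA : enrichedPresentable V κ A) : IsCardinalPresentable A κ := by
  have : (eCoyoneda V A).IsCardinalAccessible κ := hA
  have : (coyoneda.obj (op (𝟙_ V))).IsCardinalAccessible κ :=
    inferInstanceAs (IsCardinalPresentable (𝟙_ V) κ)
  exact Functor.isCardinalAccessible_of_natIso (eCoyonedaCompCoyonedaUnitIso V A) κ

lemma isCardinalAccessible_of_retract {C : Type*} [Category* C] {D : Type*} [Category* D]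
    {F F' : C ⥤ D} (h : Retract F F') [F'.IsCardinalAccessible κ] :
    F.IsCardinalAccessible κ where
  preservesColimitOfShape J _ _ := ⟨fun {T} ↦ ⟨fun {c} hc ↦ ⟨by
    have := F'.preservesColimitsOfShape_of_isCardinalAccessible κ J
    have hc' := isColimitOfPreserves F' hc
    let t (s : Cocone (T ⋙ F)) : Cocone (T ⋙ F') :=
      (Cocone.precompose (Functor.whiskerLeft T h.r)).obj s
    have hir (X : C) : h.i.app X ≫ h.r.app X = 𝟙 _ := by
      rw [← NatTrans.comp_app, h.retract, NatTrans.id_app]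
    refine
      { desc s := h.i.app _ ≫ hc'.desc (t s)
        fac s j := ?_
        uniq s m hm := ?_ }
    · have := hc'.fac (t s) j
      dsimp [t] at this ⊢
      rw [h.i.naturality_assoc, this, reassoc_of% hir]
    · have : h.r.app _ ≫ m = hc'.desc (t s) := hc'.hom_ext fun j => by
        rw [hc'.fac]
        have := hm j
        dsimp [t] at this ⊢
        rw [h.r.naturality_assoc, this]
      rw [← this, reassoc_of% hir]⟩⟩⟩

instance : (enrichedPresentable V κ : ObjectProperty K).IsStableUnderRetracts where
  of_retract {Y X} h hX := by
    have : (eCoyoneda V X).IsCardinalAccessible κ := hX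
    exact isCardinalAccessible_of_retract κ (h.op.map (eHomFunctor V K))

variable [MonoidalClosed V] [IsCardinalPresentable (𝟙_ V) κ]
  [EnrichedPurity.IsLocallyPresentable V K κ]

variable (K) in
lemma isCardinalFilteredGenerator_enrichedPresentable :
    (enrichedPresentable V κ : ObjectProperty K).IsCardinalFilteredGenerator κ where
  le_isCardinalPresentable _ hA := isCardinalPresentable_of_enrichedPresentable V κ hA
  exists_colimitsOfShape X := by
    obtain ⟨J, _, _, p, hp⟩ :=
      EnrichedPurity.IsLocallyPresentable.exists_colimitPresentation (V := V) (κ := κ) X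
    exact ⟨J, inferInstance, inferInstance, ⟨{ p with prop_diag_obj := hp }⟩⟩

/-- A `κ`-presentable object of the underlying category is a retract of an enriched
`κ`-presentable one, hence enriched `κ`-presentable itself. -/
lemma isCardinalPresentable_le_enrichedPresentable :
    isCardinalPresentable K κ ≤ enrichedPresentable V κ := by
  rw [(isCardinalFilteredGenerator_enrichedPresentable V K κ).isPresentable_eq_retractClosure,
    ObjectProperty.retractClosure_le_iff]

variable (K) in
include V in
lemma isCardinalLocallyPresentable_of_isLocallyPresentable : IsCardinalLocallyPresentable K κ :=
  have := EnrichedPurity.IsLocallyPresentable.essentiallySmall (V := V) (K := K) (κ := κ)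
  have := (isCardinalFilteredGenerator_enrichedPresentable V K κ).hasCardinalFilteredGenerator
  have := (inferInstance : EnrichedPurity.IsLocallyPresentable V K κ).toHasColimitsOfSize
  {}

end Presentable

/-! ### Purity and split monomorphisms in terms of generators -/

section Enriched

variable {V : Type u} [Category.{w} V] [MonoidalCategory V]
variable {K : Type u'} [Category.{w} K] [EnrichedOrdinaryCategory V K]

variable (V) in
/-- Composition is dinatural in the middle object. -/
lemma eHomWhiskerLeft_whiskerRight_eComp (A : K) {X Y : K} (s : X ⟶ Y) (Z : K) :
    eHomWhiskerLeft V A s ▷ _ ≫ eComp V A Y Z = _ ◁ eHomWhiskerRight V s Z ≫ eComp V A X Z := by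
  dsimp [eHomWhiskerLeft, eHomWhiskerRight]
  simp only [MonoidalCategory.whiskerLeft_comp_assoc, comp_whiskerRight_assoc, whisker_assoc_symm,
    triangle_assoc_comp_left_inv_assoc, e_assoc', assoc]

/-- Purity with respect to `g` says that morphisms `p : G i ⟶ K(A, X)` whose composite with
`K(A, f)` extends along `K(g, Y)` extend along `K(g, X)`: morphisms from `G i` to the image of
`K(g, Y)` lift to `K(B, Y)` since `G i` is regular projective. -/
lemma isPureWrt_iff_forall_generator [HasColimitsOfSize.{w, w} V] [HasPullbacks V]
    {ι : Type w} {G : ι → V} (hG : IsRegularGenerator G) (hG' : ∀ i, IsRegularProjective (G i))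
    {X Y A B : K} (f : X ⟶ Y) (g : A ⟶ B) :
    IsPureWrt (MorphismProperty.regularEpi V) (MorphismProperty.monomorphisms V) f g ↔
      ∀ i (p : G i ⟶ (A ⟶[V] X)) (q : G i ⟶ (B ⟶[V] Y)),
        p ≫ eHomWhiskerLeft V A f = q ≫ eHomWhiskerRight V g Y →
          ∃ t : G i ⟶ (B ⟶[V] X), t ≫ eHomWhiskerRight V g X = p := by
  constructor
  · rintro ⟨φ, hφ⟩ i p q h
    obtain ⟨t, ht⟩ := hG' i _ hφ (pullback.lift p (q ≫ φ.i) (by simp [h]))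
    refine ⟨t, ?_⟩
    have := ht =≫ pullback.fst _ _
    rwa [assoc, purityMap, pullback.lift_fst, pullback.lift_fst] at this
  · intro h
    have := hasFactorization_regularEpi_monomorphisms hG hG'
    let φ := MorphismProperty.factorizationData (MorphismProperty.regularEpi V)
      (MorphismProperty.monomorphisms V) (eHomWhiskerRight V g Y)
    refine ⟨φ, isRegularEpi_of_forall_generator hG _ fun i y => ?_⟩
    obtain ⟨q, hq⟩ := hG' i φ.i φ.hi (y ≫ pullback.snd _ _)
    obtain ⟨t, ht⟩ := h i (y ≫ pullback.fst _ _) q (by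
      rw [assoc, pullback.condition, ← reassoc_of% hq, φ.fac])
    have : Mono φ.p := φ.hp
    refine ⟨t, pullback.hom_ext ?_ ?_⟩
    · rw [assoc, purityMap, pullback.lift_fst, ht]
    · rw [assoc, purityMap, pullback.lift_snd, ← cancel_mono φ.p, assoc, assoc, assoc,
        φ.fac, eHom_whisker_exchange, reassoc_of% ht, pullback.condition]

/-- A filtered colimit of morphisms pure with respect to `g : A ⟶ B` is pure with respect to `g`:
by presentability of `G i`, `A` and `B`, morphisms `G i ⟶ K(A, X)` and `G i ⟶ K(B, Y)` which agree
in `K(A, Y)` come from morphisms to `K(A, X_j)` and `K(B, Y_j)` which agree in `K(A, Y_j)`,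
for some `j`. -/
lemma isPureWrt_of_colimitPresentation [HasColimitsOfSize.{w, w} V] [HasPullbacks V]
    {ι : Type w} {G : ι → V} (hG : IsRegularGenerator G) (hG' : ∀ i, IsRegularProjective (G i))
    (κ : Cardinal.{w}) [Fact κ.IsRegular]
    [∀ i, IsCardinalPresentable (G i) κ] [HasColimitsOfSize.{w, w} K]
    {J : Type w} [SmallCategory J] [IsCardinalFiltered J κ] {X Y A B : K} {f : X ⟶ Y}
    (p : ColimitPresentation J (Arrow.mk f)) (g : A ⟶ B)
    (hA : enrichedPresentable V κ A) (hB : enrichedPresentable V κ B)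
    (h : ∀ j, IsPureWrt (MorphismProperty.regularEpi V) (MorphismProperty.monomorphisms V)
      (p.diag.obj j).hom g) :
    IsPureWrt (MorphismProperty.regularEpi V) (MorphismProperty.monomorphisms V) f g := by
  simp only [isPureWrt_iff_forall_generator hG hG'] at h ⊢
  have := isFiltered_of_isCardinalFiltered J κ
  have : (eCoyoneda V A).IsCardinalAccessible κ := hA
  have : (eCoyoneda V B).IsCardinalAccessible κ := hB
  have := (eCoyoneda V A).preservesColimitsOfShape_of_isCardinalAccessible κ J
  have := (eCoyoneda V B).preservesColimitsOfShape_of_isCardinalAccessible κ J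
  have hAX := isColimitOfPreserves (Arrow.leftFunc ⋙ eCoyoneda V A) p.isColimit
  have hAY := isColimitOfPreserves (Arrow.rightFunc ⋙ eCoyoneda V A) p.isColimit
  have hBY := isColimitOfPreserves (Arrow.rightFunc ⋙ eCoyoneda V B) p.isColimit
  intro i x y hxy
  obtain ⟨j₁, x₁, hx₁⟩ := IsCardinalPresentable.exists_hom_of_isColimit κ hAX x
  obtain ⟨j₂, y₂, hy₂⟩ := IsCardinalPresentable.exists_hom_of_isColimit κ hBY y
  change G i ⟶ (A ⟶[V] (p.diag.obj j₁).left) at x₁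
  change G i ⟶ (B ⟶[V] (p.diag.obj j₂).right) at y₂
  change x₁ ≫ eHomWhiskerLeft V A (p.ι.app j₁).left = x at hx₁
  change y₂ ≫ eHomWhiskerLeft V B (p.ι.app j₂).right = y at hy₂
  have hw (j : J) : (p.ι.app j).left ≫ f = (p.diag.obj j).hom ≫ (p.ι.app j).right :=
    (p.ι.app j).w
  obtain ⟨j, a, b, hab⟩ := IsCardinalPresentable.exists_eq_of_isColimit κ hAY
    (x₁ ≫ eHomWhiskerLeft V A (p.diag.obj j₁).hom) (y₂ ≫ eHomWhiskerRight V g _) (by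
      change (x₁ ≫ eHomWhiskerLeft V A _) ≫ eHomWhiskerLeft V A (p.ι.app j₁).right =
        (y₂ ≫ eHomWhiskerRight V g _) ≫ eHomWhiskerLeft V A (p.ι.app j₂).right
      rw [assoc, assoc, ← eHomWhiskerLeft_comp, ← hw, eHomWhiskerLeft_comp, reassoc_of% hx₁,
        ← eHom_whisker_exchange, reassoc_of% hy₂, hxy]
      rfl)
  change (x₁ ≫ eHomWhiskerLeft V A _) ≫ eHomWhiskerLeft V A (p.diag.map a).right =
    (y₂ ≫ eHomWhiskerRight V g _) ≫ eHomWhiskerLeft V A (p.diag.map b).right at hab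
  have ha : (p.diag.map a).left ≫ (p.diag.obj j).hom =
    (p.diag.obj j₁).hom ≫ (p.diag.map a).right := (p.diag.map a).w
  obtain ⟨t, ht⟩ := h j i (x₁ ≫ eHomWhiskerLeft V A (p.diag.map a).left)
    (y₂ ≫ eHomWhiskerLeft V B (p.diag.map b).right) (by
      rw [assoc, assoc, ← eHomWhiskerLeft_comp, ha, eHomWhiskerLeft_comp, eHom_whisker_exchange]
      simpa using hab)
  have hp : (p.diag.map a).left ≫ (p.ι.app j).left = (p.ι.app j₁).left := by
    rw [← Arrow.comp_left, p.w]
  refine ⟨t ≫ eHomWhiskerLeft V B (p.ι.app j).left, ?_⟩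
  rw [assoc, eHom_whisker_exchange, reassoc_of% ht, ← eHomWhiskerLeft_comp, hp, hx₁]

/-- Tensoring with `P` preserves regular epimorphisms, so that a cover `e : U ⟶ 𝟙_ V` of the unit
gives a cover of `P`, which splits when `P` is regular projective. -/
lemma IsRegularProjective.exists_section_whiskerLeft [MonoidalClosed V] {P U : V}
    (hP : IsRegularProjective P) (e : U ⟶ 𝟙_ V) (he : IsRegularEpi e) :
    ∃ σ : P ⟶ P ⊗ U, σ ≫ P ◁ e = (ρ_ P).inv := by
  have hr := IsRegularEpi.getStruct e
  have : IsRegularEpi (P ◁ e) := ⟨⟨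
    { W := P ⊗ hr.W
      left := P ◁ hr.left
      right := P ◁ hr.right
      w := by rw [← MonoidalCategory.whiskerLeft_comp, hr.w, MonoidalCategory.whiskerLeft_comp]
      isColimit := isColimitCoforkMapOfIsColimit (tensorLeft P) hr.w hr.isColimit }⟩⟩
  exact hP _ this _

lemma IsRegularProjective.exists_section_whiskerRight [SymmetricCategory V] [MonoidalClosed V]
    {P U : V} (hP : IsRegularProjective P) (e : U ⟶ 𝟙_ V) (he : IsRegularEpi e) :
    ∃ σ : P ⟶ U ⊗ P, σ ≫ e ▷ P = (λ_ P).inv := by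
  obtain ⟨σ, hσ⟩ := hP.exists_section_whiskerLeft e he
  exact ⟨σ ≫ (β_ P U).hom, by
    rw [assoc, ← BraidedCategory.braiding_naturality_right, reassoc_of% hσ,
      braiding_tensorUnit_right, Iso.inv_hom_id_assoc]⟩

/-- A morphism `s` is a split monomorphism for regular epimorphisms if and only if the identity
of `X` extends along `s` after some regular epimorphism onto the unit. -/
lemma isSplit_iff_exists_cover [SymmetricCategory V] [MonoidalClosed V]
    [HasColimitsOfSize.{w, w} V] [HasPullbacks V]
    {ι : Type w} {G : ι → V} (hG : IsRegularGenerator G) (hG' : ∀ i, IsRegularProjective (G i))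
    {X Y : K} (s : X ⟶ Y) :
    IsSplit (MorphismProperty.regularEpi V) s ↔
      ∃ (U : V) (e : U ⟶ 𝟙_ V) (r : U ⟶ (Y ⟶[V] X)), IsRegularEpi e ∧
        r ≫ eHomWhiskerRight V s X = e ≫ eId V X := by
  constructor
  · intro h
    refine ⟨pullback (eHomWhiskerRight V s X) (eId V X), pullback.snd _ _, pullback.fst _ _,
      isRegularEpi_of_forall_generator hG _ fun i y => ?_, pullback.condition⟩
    obtain ⟨x, hx⟩ := hG' i _ h (y ≫ eId V X)
    exact ⟨pullback.lift x y hx, pullback.lift_snd _ _ _⟩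
  · rintro ⟨U, e, r, he, hr⟩
    refine isRegularEpi_of_forall_generator hG _ fun i y => ?_
    obtain ⟨σ, hσ⟩ := (hG' i).exists_section_whiskerRight e he
    refine ⟨σ ≫ (r ⊗ₘ y) ≫ eComp V Y X X, ?_⟩
    have h1 : (r ⊗ₘ y) ≫ eHomWhiskerRight V s X ▷ _ = e ▷ _ ≫ (λ_ _).hom ≫ y ≫ (λ_ _).inv ≫
        eId V X ▷ _ := by
      rw [tensorHom_def', assoc, ← comp_whiskerRight, hr, comp_whiskerRight,
        whisker_exchange_assoc]
      simp
    simp only [assoc]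
    rw [eComp_eHomWhiskerRight, reassoc_of% h1, reassoc_of% hσ]
    simp

end Enriched

section Quasivariety

variable {V : Type u} [Category.{w} V] [MonoidalCategory V] [SymmetricCategory V]
  [MonoidalClosed V] [HasColimitsOfSize.{w, w} V] [HasPullbacks V]
  {ι : Type w} {G : ι → V} (hG : IsRegularGenerator G) (hG' : ∀ i, IsRegularProjective (G i))
  {K : Type u'} [Category.{w} K] [EnrichedOrdinaryCategory V K]

include hG hG'

/-- A cover of the unit on which a retraction of `s` is defined yields the extension
required by purity: compose the given `q : G i ⟶ K(B, Y)` with the retraction, which is defined on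
a cover of `G i`, and use that the latter splits. -/
lemma isPureWrt_of_isSplit {X Y A B : K} {s : X ⟶ Y}
    (hs : IsSplit (MorphismProperty.regularEpi V) s) (g : A ⟶ B) :
    IsPureWrt (MorphismProperty.regularEpi V) (MorphismProperty.monomorphisms V) s g := by
  rw [isPureWrt_iff_forall_generator hG hG']
  intro i p q h
  obtain ⟨U, e, r, he, hr⟩ := (isSplit_iff_exists_cover hG hG' s).1 hs
  obtain ⟨σ, hσ⟩ := (hG' i).exists_section_whiskerLeft e he
  refine ⟨σ ≫ (q ⊗ₘ r) ≫ eComp V B Y X, ?_⟩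
  have h1 : (q ⊗ₘ r) ≫ eHomWhiskerRight V g Y ▷ _ = (p ⊗ₘ r) ≫ eHomWhiskerLeft V A s ▷ _ := by
    simp only [tensorHom_def', assoc, ← comp_whiskerRight, h]
  have h2 : (p ⊗ₘ r) ≫ _ ◁ eHomWhiskerRight V s X = _ ◁ e ≫ (ρ_ _).hom ≫ p ≫ (ρ_ _).inv ≫
      _ ◁ eId V X := by
    rw [MonoidalCategory.tensorHom_def, assoc, ← MonoidalCategory.whiskerLeft_comp, hr,
      MonoidalCategory.whiskerLeft_comp, ← whisker_exchange_assoc]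
    simp
  simp only [assoc]
  rw [eComp_eHomWhiskerRight, reassoc_of% h1, eHomWhiskerLeft_whiskerRight_eComp,
    reassoc_of% h2, reassoc_of% hσ]
  simp

/-- If `f` is pure with respect to `g`, then in a square from `g` to `f` the pushout of `g` along
the upper morphism `u` is a split monomorphism. By purity, `u` extends along `g` after
each `G i ⟶ 𝟙_ V`, which provides a retraction of the pushout defined on the canonical cover of
the unit. -/
lemma isSplit_of_isPushout {X Y A B Z : K} {f : X ⟶ Y} {g : A ⟶ B}
    [PreservesLimitsOfSize.{w, w} ((eHomFunctor V K).flip.obj X)]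
    (h : IsPureWrt (MorphismProperty.regularEpi V) (MorphismProperty.monomorphisms V) f g)
    {u : A ⟶ X} {v : B ⟶ Y} (sq : u ≫ f = g ≫ v) {a : X ⟶ Z} {b : B ⟶ Z}
    (hp : IsPushout u g a b) :
    IsSplit (MorphismProperty.regularEpi V) a := by
  rw [isPureWrt_iff_forall_generator hG hG'] at h
  rw [isSplit_iff_exists_cover hG hG']
  have hp' : IsPullback (eHomWhiskerRight V b X) (eHomWhiskerRight V a X)
      (eHomWhiskerRight V g X) (eHomWhiskerRight V u X) :=
    hp.op.map ((eHomFunctor V K).flip.obj X)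
  have key (y : Σ i, (G i ⟶ 𝟙_ V)) :
      ∃ r : G y.1 ⟶ (Z ⟶[V] X), r ≫ eHomWhiskerRight V a X = y.2 ≫ eId V X := by
    obtain ⟨t, ht⟩ := h y.1 (y.2 ≫ eHomEquiv V u) (y.2 ≫ eHomEquiv V v) (by
      simp [eHomEquiv_comp_eHomWhiskerLeft, eHomEquiv_comp_eHomWhiskerRight, sq])
    exact ⟨hp'.lift t (y.2 ≫ eId V X) (by
      rw [ht, assoc, ← eHomEquiv_id, eHomEquiv_comp_eHomWhiskerRight, comp_id]),
      hp'.lift_snd _ _ _⟩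
  choose r hr using key
  exact ⟨_, _, Sigma.desc r, hG (𝟙_ V), Sigma.hom_ext _ _ fun y => by simp [hr]⟩

end Quasivariety

/-! ### Arrows as filtered colimits of arrows between presentable objects -/

section Arrow

variable {K : Type u'} [Category.{w} K]

instance [HasColimitsOfSize.{w, w} K] : HasColimitsOfSize.{w, w} (Arrow K) :=
  ⟨fun _ _ => inferInstance⟩

/-- Morphisms from `𝟙 A` to an arrow are morphisms from `A` to its source. -/
def coyonedaArrowIdIso (A : K) :
    Arrow.leftFunc ⋙ coyoneda.obj (op A) ≅ coyoneda.obj (op (Arrow.mk (𝟙 A))) :=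
  NatIso.ofComponents (fun f => Equiv.toIso
    { toFun (x : A ⟶ f.left) := Arrow.homMk x (x ≫ f.hom) (by simp)
      invFun x := x.left
      left_inv _ := rfl
      right_inv x := Arrow.hom_ext _ _ rfl (by simp) })
    (fun {f g} φ => by
      ext x
      exact Arrow.hom_ext _ _ rfl (by
        change (x ≫ φ.left) ≫ g.hom = (x ≫ f.hom) ≫ φ.right
        exact (show ∀ y : A ⟶ f.left, (y ≫ φ.left) ≫ g.hom = (y ≫ f.hom) ≫ φ.right by simp) x))

/-- Morphisms to an arrow from an arrow with initial source are morphisms between the targets. -/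
noncomputable def coyonedaArrowInitialIso {I : K} (hI : IsInitial I) (A : K) :
    Arrow.rightFunc ⋙ coyoneda.obj (op A) ≅ coyoneda.obj (op (Arrow.mk (hI.to A))) :=
  NatIso.ofComponents (fun f => Equiv.toIso
    { toFun (x : A ⟶ f.right) := Arrow.homMk (hI.to f.left) x (hI.hom_ext _ _)
      invFun x := x.right
      left_inv _ := rfl
      right_inv x := Arrow.hom_ext _ _ (hI.hom_ext _ _) rfl })
    (fun {f g} φ => by
      ext x
      exact Arrow.hom_ext _ _ (hI.hom_ext _ _) rfl)

variable (κ : Cardinal.{w}) [Fact κ.IsRegular]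

lemma isCardinalPresentable_arrowMk_id [HasColimitsOfSize.{w, w} K] (A : K)
    [IsCardinalPresentable A κ] : IsCardinalPresentable (Arrow.mk (𝟙 A)) κ where
  preservesColimitOfShape J _ _ := by
    have := (coyoneda.obj (op A)).preservesColimitsOfShape_of_isCardinalAccessible κ J
    exact preservesColimitsOfShape_of_natIso (coyonedaArrowIdIso A)

lemma isCardinalPresentable_arrowMk_initialTo [HasColimitsOfSize.{w, w} K] {I : K}
    (hI : IsInitial I) (A : K) [IsCardinalPresentable A κ] :
    IsCardinalPresentable (Arrow.mk (hI.to A)) κ where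
  preservesColimitOfShape J _ _ := by
    have := (coyoneda.obj (op A)).preservesColimitsOfShape_of_isCardinalAccessible κ J
    exact preservesColimitsOfShape_of_natIso (coyonedaArrowInitialIso hI A)

/-- The identities of the objects satisfying `P` and the morphisms to these objects from the initial
object `I`. -/
def arrowGenerator {I : K} (hI : IsInitial I) (P : ObjectProperty K) : ObjectProperty (Arrow K) :=
  .ofObj (fun A : Subtype P => Arrow.mk (𝟙 A.1)) ⊔
    .ofObj (fun A : Subtype P => Arrow.mk (hI.to A.1))

/-- Morphisms from the identities detect sources of arrows, and morphisms from the arrows with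
initial source detect targets. -/
lemma isStrongGenerator_arrowGenerator {I : K} (hI : IsInitial I) {P : ObjectProperty K}
    (hP : P.IsStrongGenerator) : (arrowGenerator hI P).IsStrongGenerator := by
  have h₁ (A : K) (hA : P A) : arrowGenerator hI P (Arrow.mk (𝟙 A)) :=
    Or.inl (ObjectProperty.ofObj_apply (fun A : Subtype P => Arrow.mk (𝟙 A.1)) ⟨A, hA⟩)
  have h₂ (A : K) (hA : P A) : arrowGenerator hI P (Arrow.mk (hI.to A)) :=
    Or.inr (ObjectProperty.ofObj_apply (fun A : Subtype P => Arrow.mk (hI.to A.1)) ⟨A, hA⟩)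
  rw [ObjectProperty.isStrongGenerator_iff]
  refine ⟨fun f g φ ψ h => Arrow.hom_ext _ _ ?_ ?_, fun f g i _ hi => ?_⟩
  · refine hP.isSeparating _ _ fun A hA x => ?_
    exact Arrow.hom.congr_left
      (h _ (h₁ A hA) (Arrow.homMk (f := Arrow.mk (𝟙 A)) x (x ≫ f.hom) (by simp)))
  · refine hP.isSeparating _ _ fun A hA x => ?_
    exact congrArg Arrow.Hom.right
      (h _ (h₂ A hA) (Arrow.homMk (f := Arrow.mk (hI.to A)) (hI.to _) x (hI.hom_ext _ _)))
  · have : Mono i.right := ⟨fun {Z} x y hxy => by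
      have := (cancel_mono i).1 (Arrow.hom_ext
        (Arrow.homMk (f := Arrow.mk (hI.to Z)) (hI.to _) x (hI.hom_ext _ _) ≫ i)
        (Arrow.homMk (hI.to _) y (hI.hom_ext _ _) ≫ i) (hI.hom_ext _ _) hxy)
      exact congrArg Arrow.Hom.right this⟩
    have : IsIso i.left := hP.isIso_of_mono _ fun A hA x => by
      obtain ⟨y, hy⟩ := hi _ (h₁ A hA)
        (Arrow.homMk (f := Arrow.mk (𝟙 A)) x (x ≫ g.hom) (by simp))
      exact ⟨y.left, Arrow.hom.congr_left hy⟩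
    have : IsIso i.right := hP.isIso_of_mono _ fun A hA x => by
      obtain ⟨y, hy⟩ := hi _ (h₂ A hA)
        (Arrow.homMk (f := Arrow.mk (hI.to A)) (hI.to _) x (hI.hom_ext _ _))
      exact ⟨y.right, congrArg Arrow.Hom.right hy⟩
    exact Arrow.isIso_of_isIso_left_of_isIso_right i

/-- In a locally `κ`-presentable category, every arrow is a `κ`-filtered colimit of arrows
between `κ`-presentable objects. The closure of `arrowGenerator` under `κ`-small colimits provides
such arrows: their sources and targets are `κ`-presentable because colimits of arrows are computed
on sources and targets. -/
lemma exists_colimitPresentation_arrow [IsCardinalLocallyPresentable K κ] (f : Arrow K) :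
    ∃ (J : Type w) (_ : SmallCategory J) (_ : IsCardinalFiltered J κ)
      (p : ColimitPresentation J f), ∀ j, IsCardinalPresentable (p.diag.obj j).left κ ∧
        IsCardinalPresentable (p.diag.obj j).right κ := by
  obtain ⟨P, _, hP⟩ := HasCardinalFilteredGenerator.exists_small_generator K κ
  have hI : IsInitial (⊥_ K) := initialIsInitial
  let Q : ObjectProperty (Arrow K) :=
    (isCardinalPresentable K κ).inverseImage Arrow.leftFunc ⊓
      (isCardinalPresentable K κ).inverseImage Arrow.rightFunc
  have : ObjectProperty.Small.{w} (arrowGenerator hI P) := by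
    dsimp [arrowGenerator]; infer_instance
  have hle : arrowGenerator hI P ≤ isCardinalPresentable (Arrow K) κ := by
    rintro _ (⟨⟨A⟩⟩ | ⟨⟨A⟩⟩)
    · have : IsCardinalPresentable A.1 κ := hP.le_isCardinalPresentable _ A.2
      exact isCardinalPresentable_arrowMk_id κ A.1
    · have : IsCardinalPresentable A.1 κ := hP.le_isCardinalPresentable _ A.2
      exact isCardinalPresentable_arrowMk_initialTo κ hI A.1
  have hleQ : (arrowGenerator hI P).colimitsCardinalClosure κ ≤ Q := by
    refine ObjectProperty.colimitsCardinalClosure_le _ _ (fun J _ hJ => ⟨?_⟩) ?_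
    · have := isClosedUnderColimitsOfShape_isCardinalPresentable K hJ
      rintro X ⟨hX⟩
      exact ⟨ObjectProperty.prop_of_isColimit _ (isColimitOfPreserves Arrow.leftFunc hX.isColimit)
          fun j => (hX.prop_diag_obj j).1,
        ObjectProperty.prop_of_isColimit _ (isColimitOfPreserves Arrow.rightFunc hX.isColimit)
          fun j => (hX.prop_diag_obj j).2⟩
    · -- As an empty colimit, the initial object is `κ`-presentable.
      have hI' : isCardinalPresentable K κ (⊥_ K) :=
        have (k : Discrete PEmpty.{1}) : IsCardinalPresentable ((Functor.empty K).obj k) κ :=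
          k.as.elim
        isCardinalPresentable_of_isColimit' _ (colimit.isColimit (Functor.empty.{0} K)) κ
          (by
            refine .of_le ?_ (Cardinal.IsRegular.aleph0_le Fact.out)
            simp only [hasCardinalLT_aleph0_iff]
            infer_instance)
      rintro _ (⟨⟨A⟩⟩ | ⟨⟨A⟩⟩)
      · exact ⟨hP.le_isCardinalPresentable _ A.2, hP.le_isCardinalPresentable _ A.2⟩
      · exact ⟨hI', hP.le_isCardinalPresentable _ A.2⟩
  have := (isStrongGenerator_arrowGenerator hI
    hP.isStrongGenerator).isDense_colimitsCardinalClosure_ι hle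
  obtain ⟨J, _, _, ⟨p⟩⟩ := (IsCardinalFilteredGenerator.of_isDense_ι
    ((arrowGenerator hI P).colimitsCardinalClosure κ) κ
    (ObjectProperty.colimitsCardinalClosure_le_isCardinalPresentable _
      hle)).exists_colimitsOfShape f
  exact ⟨J, inferInstance, inferInstance, p.toColimitPresentation,
    fun j => hleQ _ (p.prop_diag_obj j)⟩

end Arrow

/-! ### An arrow as a colimit of pushouts -/

section Pushout

variable {C : Type*} [Category* C] [HasPushouts C] {J : Type*} [Category* J] {X Y : C}

section Transition

variable {g₁ g₂ g₃ : Arrow C} {X : C} (x₁ : g₁.left ⟶ X) (x₂ : g₂.left ⟶ X) (x₃ : g₃.left ⟶ X)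

/-- The morphism induced on pushouts by a morphism of arrows over `X`. -/
noncomputable def pushoutTransition (φ : g₁ ⟶ g₂) (hφ : φ.left ≫ x₂ = x₁) :
    pushout x₁ g₁.hom ⟶ pushout x₂ g₂.hom :=
  pushout.desc (pushout.inl _ _) (φ.right ≫ pushout.inr x₂ g₂.hom) (by
    rw [← hφ, assoc, pushout.condition, Arrow.w_assoc])

lemma inl_pushoutTransition (φ : g₁ ⟶ g₂) (hφ : φ.left ≫ x₂ = x₁) :
    pushout.inl _ _ ≫ pushoutTransition x₁ x₂ φ hφ = pushout.inl _ _ :=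
  pushout.inl_desc _ _ _

lemma inr_pushoutTransition (φ : g₁ ⟶ g₂) (hφ : φ.left ≫ x₂ = x₁) :
    pushout.inr _ _ ≫ pushoutTransition x₁ x₂ φ hφ = φ.right ≫ pushout.inr x₂ g₂.hom :=
  pushout.inr_desc _ _ _

lemma pushoutTransition_id : pushoutTransition x₁ x₁ (𝟙 g₁) (by simp) = 𝟙 _ :=
  pushout.hom_ext (by rw [inl_pushoutTransition, comp_id])
    (by rw [inr_pushoutTransition, Arrow.id_right, id_comp, comp_id])

lemma pushoutTransition_comp (φ : g₁ ⟶ g₂) (hφ : φ.left ≫ x₂ = x₁)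
    (ψ : g₂ ⟶ g₃) (hψ : ψ.left ≫ x₃ = x₂)
    (h : (φ ≫ ψ).left ≫ x₃ = x₁) :
    pushoutTransition x₁ x₃ (φ ≫ ψ) h =
      pushoutTransition x₁ x₂ φ hφ ≫ pushoutTransition x₂ x₃ ψ hψ := by
  refine pushout.hom_ext ?_ ?_
  · rw [inl_pushoutTransition, ← assoc, inl_pushoutTransition, inl_pushoutTransition]
  · rw [inr_pushoutTransition, ← assoc, inr_pushoutTransition, assoc, inr_pushoutTransition,
      Arrow.comp_right, assoc]

lemma pushoutTransition_desc (φ : g₁ ⟶ g₂) (hφ : φ.left ≫ x₂ = x₁)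
    {Y : C} {f : X ⟶ Y} {y₁ : g₁.right ⟶ Y} {y₂ : g₂.right ⟶ Y} (h₁ : x₁ ≫ f = g₁.hom ≫ y₁)
    (h₂ : x₂ ≫ f = g₂.hom ≫ y₂) (h : φ.right ≫ y₂ = y₁) :
    pushoutTransition x₁ x₂ φ hφ ≫ pushout.desc f y₂ h₂ = pushout.desc f y₁ h₁ := by
  refine pushout.hom_ext ?_ ?_
  · rw [← assoc, inl_pushoutTransition, pushout.inl_desc, pushout.inl_desc]
  · rw [← assoc, inr_pushoutTransition, assoc, pushout.inr_desc, pushout.inr_desc, h]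

end Transition

/-- For a diagram of arrows `X_j ⟶ Y_j` and a cocone `α` with point `X` on the sources, the
diagram of the pushouts `X ⟶ X ⨿_{X_j} Y_j`. -/
noncomputable def pushoutDiagram (D : J ⥤ Arrow C) (α : ∀ j, (D.obj j).left ⟶ X)
    (hα : ∀ ⦃j k : J⦄ (a : j ⟶ k), (D.map a).left ≫ α k = α j) : J ⥤ Arrow C where
  obj j := Arrow.mk (pushout.inl (α j) (D.obj j).hom)
  map {j k} a := Arrow.homMk (𝟙 X)
    (pushoutTransition (α j) (α k) (D.map a) (hα a))
    ((id_comp _).trans (inl_pushoutTransition _ _ _ _).symm)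
  map_id j := Arrow.hom_ext _ _ rfl (by
    simpa only [D.map_id] using! pushoutTransition_id (α j))
  map_comp {i j k} a b := Arrow.hom_ext _ _ (id_comp (𝟙 X)).symm (by
    simpa only [D.map_comp] using! pushoutTransition_comp (α i) (α j) (α k) (D.map a) (hα a)
      (D.map b) (hα b) (by simpa only [D.map_comp] using hα (a ≫ b)))

/-- For `J` connected, the colimit `f : X ⟶ Y` of arrows `X_j ⟶ Y_j` is also the colimit of the
pushouts `X ⟶ X ⨿_{X_j} Y_j`: on sources the diagram is constant, and a cocone on the objects
`X ⨿_{X_j} Y_j` is a cocone on the objects `Y_j` with a compatible morphism from `X`. -/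
lemma exists_colimitPresentation_pushoutDiagram [IsConnected J] {f : X ⟶ Y}
    (p : ColimitPresentation J (Arrow.mk f))
    [PreservesColimit p.diag Arrow.leftFunc] [PreservesColimit p.diag Arrow.rightFunc] :
    ∃ p' : ColimitPresentation J (Arrow.mk f), p'.diag = pushoutDiagram (X := X) p.diag
      (fun j => (p.ι.app j).left) (fun _ _ a => Arrow.hom.congr_left (p.w a)) := by
  have hl := isColimitOfPreserves Arrow.leftFunc p.isColimit
  have hr := isColimitOfPreserves Arrow.rightFunc p.isColimit
  let α (j : J) : (p.diag.obj j).left ⟶ X := (p.ι.app j).left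
  let β (j : J) : (p.diag.obj j).right ⟶ Y := (p.ι.app j).right
  have hα ⦃j k : J⦄ (a : j ⟶ k) : (p.diag.map a).left ≫ α k = α j := Arrow.hom.congr_left (p.w a)
  have hβ ⦃j k : J⦄ (a : j ⟶ k) : (p.diag.map a).right ≫ β k = β j :=
    congrArg Arrow.Hom.right (p.w a)
  have hαβ (j : J) : α j ≫ f = (p.diag.obj j).hom ≫ β j := (p.ι.app j).w
  let D := pushoutDiagram p.diag α hα
  let ι : D ⟶ (Functor.const J).obj (Arrow.mk f) :=
    { app j := Arrow.homMk (f := Arrow.mk (pushout.inl (α j) (p.diag.obj j).hom)) (𝟙 X)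
        (pushout.desc f (β j) (hαβ j)) ((id_comp f).trans (pushout.inl_desc _ _ _).symm)
      naturality j k a := Arrow.hom_ext _ _ rfl
        ((pushoutTransition_desc _ _ _ (hα a) (hαβ j) (hαβ k) (hβ a)).trans (comp_id _).symm) }
  -- The components of a cocone `s` on the pushouts; those on the constant sources are all equal.
  let l (s : Cocone D) (j : J) : X ⟶ s.pt.left := (s.ι.app j).left
  let r (s : Cocone D) (j : J) : pushout (α j) (p.diag.obj j).hom ⟶ s.pt.right :=
    (s.ι.app j).right
  have hl' (s : Cocone D) (j : J) : l s j = l s (Classical.arbitrary J) :=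
    constant_of_preserves_morphisms (l s)
      (fun j k a => (Arrow.hom.congr_left (s.w a)).symm.trans (id_comp _)) _ _
  have hr' (s : Cocone D) ⦃j k : J⦄ (a : j ⟶ k) :
      pushoutTransition (α j) (α k) (p.diag.map a) (hα a) ≫ r s k = r s j :=
    congrArg Arrow.Hom.right (s.w a)
  have hlr (s : Cocone D) (j : J) :
      pushout.inl (α j) (p.diag.obj j).hom ≫ r s j = l s (Classical.arbitrary J) ≫ s.pt.hom := by
    rw [← hl' s j]
    exact (s.ι.app j).w.symm
  -- The cocone on the targets `Y_j` obtained from `s` by restriction along `Y_j ⟶ X ⨿_{X_j} Y_j`.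
  let c (s : Cocone D) : Cocone (p.diag ⋙ Arrow.rightFunc) :=
    { pt := s.pt.right
      ι :=
        { app j := pushout.inr (α j) (p.diag.obj j).hom ≫ r s j
          naturality j k a := by
            have h : (p.diag.map a).right ≫ pushout.inr (α k) (p.diag.obj k).hom ≫ r s k =
                pushout.inr (α j) (p.diag.obj j).hom ≫ r s j := by
              rw [← assoc, ← inr_pushoutTransition (α j) (α k) _ (hα a), assoc, hr']
            exact h.trans (comp_id _).symm } }
  let d (s : Cocone D) : Y ⟶ s.pt.right := hr.desc (c s)
  have hd (s : Cocone D) (j : J) : β j ≫ d s =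
      pushout.inr (α j) (p.diag.obj j).hom ≫ r s j := hr.fac (c s) j
  -- Both sides agree on the objects `X_j`, of which `X` is the colimit.
  have hfd (s : Cocone D) : l s (Classical.arbitrary J) ≫ s.pt.hom = f ≫ d s := by
    refine hl.hom_ext fun j => ?_
    change α j ≫ _ = α j ≫ _
    rw [reassoc_of% hαβ j, hd, ← hlr s j, pushout.condition_assoc]
  let desc (s : Cocone D) : Arrow.mk f ⟶ s.pt :=
    Arrow.homMk (l s (Classical.arbitrary J)) (d s) (hfd s)
  refine ⟨⟨D, ι,
    { desc := desc
      fac s j := Arrow.hom_ext _ _ ?_ ?_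
      uniq s m hm := Arrow.hom_ext _ _ ?_ ?_ }⟩, rfl⟩
  · exact (id_comp _).trans (hl' s j).symm
  · refine pushout.hom_ext ?_ ?_
    · exact (pushout.inl_desc_assoc _ _ _ _).trans ((hfd s).symm.trans (hlr s j).symm)
    · exact (pushout.inr_desc_assoc _ _ _ _).trans (hd s j)
  · exact (id_comp _).symm.trans (Arrow.hom.congr_left (hm (Classical.arbitrary J)))
  · refine hr.hom_ext fun j => ?_
    have h₁ : pushout.desc f (β j) (hαβ j) ≫ m.right = r s j :=
      congrArg Arrow.Hom.right (hm j)
    have h₂ := pushout.inr_desc_assoc f (β j) (hαβ j) m.right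
    rw [h₁] at h₂
    exact h₂.symm.trans (hd s j).symm

end Pushout
end EnrichedPurity

theorem mainTheorem6
    {V : Type u} [Category.{w} V] [MonoidalCategory V] [SymmetricCategory V] [MonoidalClosed V]
    [HasLimitsOfSize.{w, w} V] [HasColimitsOfSize.{w, w} V]
    (κ : Cardinal.{w}) [Fact κ.IsRegular]
    [EnrichedPurity.IsSymmetricMonoidalQuasivariety V κ]
    {K : Type u'} [Category.{w} K] [EnrichedOrdinaryCategory V K]
    [EnrichedPurity.IsLocallyPresentable V K κ] :
    (∀ ⦃X Y : K⦄ (s : X ⟶ Y),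
      EnrichedPurity.IsSplit (MorphismProperty.regularEpi V) s →
        EnrichedPurity.IsPure (MorphismProperty.regularEpi V)
          (MorphismProperty.monomorphisms V) s κ) ∧
    (∀ (J : Type w) [SmallCategory J] [IsCardinalFiltered J κ] ⦃X Y : K⦄ (f : X ⟶ Y)
      (p : ColimitPresentation J (Arrow.mk f)),
      (∀ j, EnrichedPurity.IsPure (MorphismProperty.regularEpi V)
        (MorphismProperty.monomorphisms V) (p.diag.obj j).hom κ) →
          EnrichedPurity.IsPure (MorphismProperty.regularEpi V)
            (MorphismProperty.monomorphisms V) f κ) ∧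
    (∀ ⦃X Y : K⦄ (f : X ⟶ Y),
      EnrichedPurity.IsPure (MorphismProperty.regularEpi V)
        (MorphismProperty.monomorphisms V) f κ →
        ∃ (J : Type w) (_ : SmallCategory J) (_ : IsCardinalFiltered J κ)
          (p : ColimitPresentation J (Arrow.mk f)),
          ∀ j, EnrichedPurity.IsSplit (MorphismProperty.regularEpi V) (p.diag.obj j).hom) := by
  obtain ⟨ι, G, hG, hG', -⟩ :=
    EnrichedPurity.IsSymmetricMonoidalQuasivariety.exists_generator (V := V) (κ := κ)
  have hproj (i : ι) := (hG' i).2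
  have (i : ι) : IsCardinalPresentable (G i) κ := (hG' i).1
  have : IsCardinalPresentable (𝟙_ V) κ :=
    EnrichedPurity.IsSymmetricMonoidalQuasivariety.unit_presentable
  have := EnrichedPurity.isCardinalLocallyPresentable_of_isLocallyPresentable V K κ
  refine ⟨fun X Y s hs A B g _ _ => EnrichedPurity.isPureWrt_of_isSplit hG hproj hs g,
    fun J _ _ X Y f p h A B g hA hB => EnrichedPurity.isPureWrt_of_colimitPresentation hG hproj κ
      p g hA hB fun j => h j g hA hB, fun X Y f hf => ?_⟩
  obtain ⟨J, _, _, p, hp⟩ := EnrichedPurity.exists_colimitPresentation_arrow κ (Arrow.mk f)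
  have := isFiltered_of_isCardinalFiltered J κ
  have := IsFiltered.isConnected J
  obtain ⟨p', hp'⟩ := EnrichedPurity.exists_colimitPresentation_pushoutDiagram p
  refine ⟨J, inferInstance, inferInstance, p', fun j => ?_⟩
  rw [hp']
  have := EnrichedPurity.HasConicalColimits.preservesLimits (V := V) X
  have hle := EnrichedPurity.isCardinalPresentable_le_enrichedPresentable V (K := K) κ
  exact EnrichedPurity.isSplit_of_isPushout hG hproj
    (hf (p.diag.obj j).hom (hle _ (hp j).1) (hle _ (hp j).2)) (p.ι.app j).w
    (IsPushout.of_hasPushout _ _)
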